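/- Let $\mathcal{A}$ be a unital $C^*$-algebra over $\mathbb{C}$ and let $a\in\mathcal{A}$. Write $\operatorname{soc}(\mathcal{A})$ for the socle of $\mathcal{A}$, i.e. the sum of all minimal left ideals of $\mathcal{A}$ (a two-sided ideal), and for a left ideal $L\subseteq\mathcal{A}$ put $L^*=\{x^*: x\in L\}$ and $\delta(L)=\operatorname{codim}_{\mathbb{C}}(L+L^*)=\dim_{\mathbb{C}}\mathcal{A}/(L+L^*)$. Then the following statements are equivalent: 1. $a$ is weak$^+$-Fredholm, i.e. the left $\mathcal{A}$-module $\mathcal{A}/\mathcal{A}a$ has finite length; 2. $a$ is semi$^+$-Fredholm, i.e. the class of $a$ is left invertible in the quotient ring $\mathcal{A}/\operatorname{soc}(\mathcal{A})$; 3. $\delta(\mathcal{A}a)<\infty$ and $\mathcal{A}a$ is closed in $\mathcal{A}$. -/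

import Mathlib

namespace CStarFredholm

/-- The socle of a ring: the sum of all minimal left ideals. (In a semiprime ring, such as a
C*-algebra, this is also the sum of all minimal right ideals.) -/
def socle (A : Type*) [Ring A] : Ideal A :=
  sSup {m : Ideal A | IsAtom m}

instance socle_isTwoSided (A : Type*) [Ring A] : (socle A).IsTwoSided := by
  refine ⟨fun {x} r hx => ?_⟩
  have key : socle A ≤ Submodule.comap (LinearMap.toSpanSingleton A A r) (socle A) := by
    refine sSup_le fun m hm => ?_
    rw [← Submodule.map_le_iff_le_comap]
    have hm' : IsAtom m := hm
    have : IsSimpleModule A m := isSimpleModule_iff_isAtom.mpr hm'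
    rcases LinearMap.injective_or_eq_zero
        ((LinearMap.toSpanSingleton A A r).comp m.subtype) with h | h
    · refine le_sSup (isSimpleModule_iff_isAtom.mp ?_)
      have e := LinearEquiv.ofInjective _ h
      rw [LinearMap.range_comp, Submodule.range_subtype] at e
      exact IsSimpleModule.congr e.symm
    · rintro _ ⟨y, hy, rfl⟩
      have h0 : (LinearMap.toSpanSingleton A A r) y = 0 := LinearMap.congr_fun h ⟨y, hy⟩
      rw [h0]
      exact zero_mem _
  exact key hx

/-- `ξ_l(a)`: the length of the left `A`-module `A / Aa`. -/
noncomputable def xiLeft {A : Type*} [Ring A] (a : A) : ℕ∞ :=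
  Module.length A (A ⧸ (Ideal.span {a} : Ideal A))

/-- `a` is weak⁺-Fredholm if the left `A`-module `A / Aa` has finite length. -/
def IsWeakPlusFredholm {A : Type*} [Ring A] (a : A) : Prop :=
  xiLeft a < ⊤

/-- `a` is semi⁺-Fredholm if its class is left invertible in the ring `A / soc(A)`. -/
def IsSemiPlusFredholm {A : Type*} [Ring A] (a : A) : Prop :=
  ∃ b : A ⧸ socle A, b * Ideal.Quotient.mk (socle A) a = 1

/-- The complex subspace `L + L*` attached to a left ideal `L`, where `L* = {x* | x ∈ L}`. -/
noncomputable def addStar {A : Type*} [CStarAlgebra A] (L : Ideal A) : Submodule ℂ A :=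
  L.restrictScalars ℂ ⊔ (L.restrictScalars ℂ).map (starLinearEquiv ℂ : A ≃ₗ⋆[ℂ] A).toLinearMap

/-- `δ(L)`: the codimension of the complex subspace `L + L*` in `A` (`⊤` if it is infinite). -/
noncomputable def delta {A : Type*} [CStarAlgebra A] (L : Ideal A) : ℕ∞ :=
  Cardinal.toENat (Module.rank ℂ (A ⧸ addStar L))

end CStarFredholm

/-! When `Aa` is closed it equals `A(1 - q)` for a projection `q` with `aq = 0`
(`exists_projection_of_isClosed`), and all three conditions become statements about `q`.
`delta_lt_top_iff_sandwich` identifies condition 3 with finite dimensionality of `qAq`. Finite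
length makes `Aa` closed by perturbing generators of its closure (`eq_of_le_closure`). It also puts
`q` in the socle, since `Aq` is an Artinian quotient of `A/Aa` and the radical is zero; then `b * a
= 1 - q` gives 2, and Schur's lemma makes `qAq` finite-dimensional. From 2, `A/Aa` is a cyclic
quotient of the semisimple socle. From 3, left ideals containing `1 - q` are determined by their
corners in `qAq` (`le_of_map_sandwich_le`), which bounds chains. -/

namespace CStarFredholm

/-! ### Support projections and closed principal left ideals -/

section Support
variable {A : Type*} [CStarAlgebra A]

/-- If `0` is not an accumulation point of the spectrum of `star a * a`, then the support projection
of `a` lies in `A (star a * a)`. -/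
theorem exists_support_projection (a : A)
    (hc : ContinuousOn (fun t : ℝ => t⁻¹) (spectrum ℝ (star a * a))) :
    ∃ c : A, IsStarProjection (c * (star a * a)) ∧ a * (c * (star a * a)) = a := by
  set h := star a * a with hh
  have hsa : IsSelfAdjoint h := IsSelfAdjoint.star_mul_self a
  have hp : cfc (fun t : ℝ => t⁻¹ * t) h = cfc (fun t : ℝ => t⁻¹) h * h := by
    rw [cfc_mul (fun t : ℝ => t⁻¹) (fun t => t) h hc, cfc_id' ℝ h]
  have hcc : ContinuousOn (fun t : ℝ => t⁻¹ * t) (spectrum ℝ h) := hc.mul continuousOn_id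
  refine ⟨cfc (fun t : ℝ => t⁻¹) h, ?_⟩
  rw [← hp]
  -- Since `0⁻¹ = 0`, the function is the indicator of `t ≠ 0`.
  set p := cfc (fun t : ℝ => t⁻¹ * t) h with hpdef
  have hpsa : IsSelfAdjoint p := cfc_predicate _ _
  have hpp : p * p = p := by
    rw [hpdef, ← cfc_mul (fun t : ℝ => t⁻¹ * t) (fun t : ℝ => t⁻¹ * t) h hcc hcc]
    refine cfc_congr fun t _ => ?_
    by_cases ht : t = 0 <;> simp [ht]
  have hhp : h * p = h := by
    nth_rewrite 1 [← cfc_id' ℝ h]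
    rw [hpdef, ← cfc_mul (fun t : ℝ => t) (fun t : ℝ => t⁻¹ * t) h continuousOn_id hcc]
    conv_rhs => rw [← cfc_id' ℝ h]
    refine cfc_congr fun t _ => ?_
    by_cases ht : t = 0 <;> simp [ht]
  refine ⟨⟨hpp, hpsa⟩, ?_⟩
  have : star (a * p - a) * (a * p - a) = 0 := by
    rw [star_sub, star_mul, hpsa.star_eq]
    have : (p * star a - star a) * (a * p - a) = p * (h * p) - p * h - (h * p - h) := by
      rw [hh]; noncomm_ring
    rw [this, hhp]; simp
  rwa [CStarRing.star_mul_self_eq_zero_iff, sub_eq_zero] at this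

theorem continuousOn_inv_of_isolated_zero {s : Set ℝ} {c : ℝ} (hc : 0 < c)
    (hs : ∀ t ∈ s, t = 0 ∨ c ≤ t) : ContinuousOn (fun t : ℝ => t⁻¹) s := by
  intro t ht
  rcases hs t ht with rfl | h
  · refine ContinuousWithinAt.congr_of_eventuallyEq (f := fun _ => (0 : ℝ))
      continuousWithinAt_const ?_ (by simp)
    filter_upwards [self_mem_nhdsWithin, nhdsWithin_le_nhds (Iio_mem_nhds hc)] with x hx hxc
    rcases hs x hx with rfl | h'
    · simp
    · exact absurd hxc (not_lt.mpr h')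
  · exact (continuousAt_inv₀ (by linarith)).continuousWithinAt

/-- A closed principal left ideal of a C*-algebra is generated by a projection. -/
theorem exists_projection_of_isClosed (a : A)
    (ha : IsClosed ((Ideal.span {a} : Ideal A) : Set A)) :
    ∃ b : A, IsStarProjection (b * a) ∧ a * (b * a) = a := by
  let V : Submodule ℂ A := (Ideal.span {a} : Ideal A).restrictScalars ℂ
  have hV : IsClosed (V : Set A) := ha
  have : CompleteSpace V := hV.completeSpace_coe
  let R : A →L[ℂ] V :=
    ((ContinuousLinearMap.mul ℂ A).flip a).codRestrict V
      (fun x => Ideal.mul_mem_left _ x (Ideal.mem_span_singleton_self a))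
  have hR : Function.Surjective R := by
    rintro ⟨y, hy⟩
    obtain ⟨b, hb⟩ := Ideal.mem_span_singleton'.mp hy
    exact ⟨b, Subtype.ext hb⟩
  obtain ⟨C, hC, hC'⟩ := R.exists_preimage_norm_le hR
  let := CStarAlgebra.spectralOrder A
  let := CStarAlgebra.spectralOrderedRing A
  suffices hc : ContinuousOn (fun t : ℝ => t⁻¹) (spectrum ℝ (star a * a)) by
    obtain ⟨c, hc⟩ := exists_support_projection a hc
    exact ⟨c * star a, by simpa only [mul_assoc] using hc⟩
  set h := star a * a with hh
  have hsa : IsSelfAdjoint h := IsSelfAdjoint.star_mul_self a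
  have hnn : 0 ≤ h := star_mul_self_nonneg a
  -- For `s > 0` in the spectrum and `k t = t / (t + s)`, the open mapping theorem gives `k(h) = b *
  -- a` with `‖b‖ ≤ C`. Hence `k(h)² ≤ C² h`, and evaluating at `s` yields `1/4 ≤ C² s`.
  refine continuousOn_inv_of_isolated_zero (c := 1 / (4 * C ^ 2)) (by positivity) fun s hs => ?_
  have hspec : ∀ t ∈ spectrum ℝ h, 0 ≤ t := fun t ht => spectrum_nonneg_of_nonneg hnn ht
  rcases (hspec s hs).eq_or_lt with h0 | h0
  · exact Or.inl h0.symm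
  right
  let k : ℝ → ℝ := fun t => (t + s)⁻¹ * t
  have hinv : ContinuousOn (fun t : ℝ => (t + s)⁻¹) (spectrum ℝ h) := by
    refine ContinuousOn.inv₀ (by fun_prop) fun t ht => ?_
    have := hspec t ht
    positivity
  have hk : ContinuousOn k (spectrum ℝ h) := hinv.mul continuousOn_id
  have hky : cfc k h = cfc (fun t : ℝ => (t + s)⁻¹) h * h := by
    rw [cfc_mul (fun t : ℝ => (t + s)⁻¹) (fun t => t) h hinv, cfc_id' ℝ h]
  have hmem : cfc k h ∈ V := by
    rw [hky, hh, ← mul_assoc]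
    exact Ideal.mul_mem_left _ _ (Ideal.mem_span_singleton_self a)
  obtain ⟨b, hb, hbn⟩ := hC' ⟨cfc k h, hmem⟩
  have hb' : b * a = cfc k h := congrArg Subtype.val hb
  have hnorm : ‖cfc k h‖ ≤ 1 := by
    refine norm_cfc_le zero_le_one fun t ht => ?_
    have := hspec t ht
    rw [Real.norm_of_nonneg (by positivity), inv_mul_le_one₀ (by positivity)]
    linarith
  have hbC : ‖b‖ ≤ C := hbn.trans (by
    have : ‖(⟨cfc k h, hmem⟩ : V)‖ ≤ 1 := hnorm
    nlinarith)
  have hle : cfc (fun t => k t * k t) h ≤ cfc (fun t : ℝ => C ^ 2 * t) h := by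
    rw [cfc_mul k k h hk hk, cfc_const_mul (C ^ 2) (fun t : ℝ => t) h, cfc_id' ℝ h]
    have hks : star (cfc k h) = cfc k h := IsSelfAdjoint.star_eq (cfc_predicate _ _)
    nth_rewrite 1 [← hks]
    rw [← hb', star_mul]
    have h1 : star b * b ≤ algebraMap ℝ A (C ^ 2) :=
      CStarAlgebra.star_mul_le_algebraMap_norm_sq.trans
        (algebraMap_mono A (by gcongr))
    have h2 := star_left_conjugate_le_conjugate h1 a
    calc star a * star b * (b * a) = star a * (star b * b) * a := by noncomm_ring
      _ ≤ _ := h2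
      _ = C ^ 2 • h := by
        rw [← Algebra.commutes, mul_assoc, ← hh, Algebra.smul_def]
  have hfin := (cfc_le_iff (fun t => k t * k t) (fun t : ℝ => C ^ 2 * t) h (hk.mul hk)
    (by fun_prop)).mp hle s hs
  have hks : k s = 1 / 2 := by simp only [k]; field_simp; norm_num
  rw [hks] at hfin
  rw [div_le_iff₀ (by positivity)]
  linarith

end Support
end CStarFredholm

namespace CStarFredholm

/-! ### Closedness from finite generation -/

section Closed
variable {A : Type*} [NormedRing A] [NormedAlgebra ℂ A] [CompleteSpace A]

/-- A dense submodule of a finitely generated closed left ideal is everything. -/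
theorem eq_of_le_closure {I L : Ideal A} (hIL : I ≤ L) (hLI : (L : Set A) ⊆ closure I)
    (hL : IsClosed (L : Set A)) (hfg : L.FG) : I = L := by
  obtain ⟨n, s, hs⟩ := Submodule.fg_iff_exists_fin_generating_family.mp hfg
  have hsL : ∀ i, s i ∈ L := fun i => hs ▸ Submodule.subset_span ⟨i, rfl⟩
  let V : Submodule ℂ A := L.restrictScalars ℂ
  have hV : IsClosed (V : Set A) := hL
  have : CompleteSpace V := hV.completeSpace_coe
  let T₀ : (Fin n → A) →L[ℂ] A :=
    ∑ i, ((ContinuousLinearMap.mul ℂ A).flip (s i)).comp (ContinuousLinearMap.proj i)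
  have hT₀ : ∀ b, T₀ b = ∑ i, b i * s i := fun b => by simp [T₀]
  let T : (Fin n → A) →L[ℂ] V := T₀.codRestrict V fun b => by
    rw [hT₀]
    exact L.sum_mem fun i _ => L.mul_mem_left _ (hsL i)
  have hT : ∀ b, (T b : A) = ∑ i, b i * s i := hT₀
  have hsurj : Function.Surjective T := by
    rintro ⟨y, hy⟩
    have hy' : y ∈ Submodule.span A (Set.range s) := hs ▸ hy
    obtain ⟨c, hc⟩ := (Submodule.mem_span_range_iff_exists_fun A).mp hy'
    exact ⟨c, Subtype.ext ((hT c).trans hc)⟩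
  obtain ⟨C, hC, hC'⟩ := T.exists_preimage_norm_le hsurj
  -- Makes `n * C * ε ≤ 1/2`, including when `n = 0`.
  set ε : ℝ := 1 / (2 * C * (n + 1)) with hε
  have hεpos : 0 < ε := by positivity
  have happrox : ∀ i, ∃ x ∈ I, ‖s i - x‖ < ε := fun i => by
    obtain ⟨x, hx, hd⟩ := Metric.mem_closure_iff.mp (hLI (hsL i)) ε hεpos
    exact ⟨x, hx, by rwa [← dist_eq_norm]⟩
  choose x hxI hx using happrox
  have hdiff : ∀ i, ∃ c : Fin n → A, ∑ j, c j * s j = s i - x i ∧ ‖c‖ ≤ C * ε := fun i => by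
    obtain ⟨c, hc, hcn⟩ := hC' ⟨s i - x i, L.sub_mem (hsL i) (hIL (hxI i))⟩
    refine ⟨c, by rw [← hT, hc], hcn.trans ?_⟩
    exact mul_le_mul_of_nonneg_left (hx i).le hC.le
  choose c hc hcn using hdiff
  -- Right multiplication by the matrix `c`, which writes `s i - x i` in the generators `s`.
  -- Inverting `1 - U` by a Neumann series turns coefficients over `s` into coefficients over `x`.
  let U : (Fin n → A) →L[ℂ] (Fin n → A) :=
    ContinuousLinearMap.pi fun j =>
      ∑ i, ((ContinuousLinearMap.mul ℂ A).flip (c i j)).comp (ContinuousLinearMap.proj i)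
  have hU : ∀ b j, U b j = ∑ i, b i * c i j := fun b j => by
    simp [U]
  have hUn : ‖U‖ < 1 := by
    refine lt_of_le_of_lt (U.opNorm_le_bound (M := 1 / 2) (by norm_num) fun b => ?_) (by norm_num)
    refine (pi_norm_le_iff_of_nonneg (by positivity)).mpr fun j => ?_
    rw [hU]
    calc ‖∑ i, b i * c i j‖ ≤ ∑ i : Fin n, ‖b‖ * (C * ε) := by
          refine norm_sum_le_of_le _ fun i _ => (norm_mul_le _ _).trans ?_
          exact mul_le_mul (norm_le_pi_norm b i) ((norm_le_pi_norm (c i) j).trans (hcn i))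
            (norm_nonneg _) (norm_nonneg _)
      _ = (n * (C * ε)) * ‖b‖ := by simp; ring
      _ ≤ 1 / 2 * ‖b‖ := by
          gcongr
          rw [hε]
          have hn : (0 : ℝ) ≤ n := n.cast_nonneg
          rw [show (n : ℝ) * (C * (1 / (2 * C * (n + 1)))) = n / (2 * (n + 1)) by field_simp,
            div_le_div_iff₀ (by positivity) (by norm_num)]
          linarith
  refine le_antisymm hIL fun y hy => ?_
  obtain ⟨b', hb'⟩ := hsurj ⟨y, hy⟩
  let u := Units.oneSub U hUn
  let b := (↑u⁻¹ : (Fin n → A) →L[ℂ] (Fin n → A)) b'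
  have hb : b - U b = b' := by
    have : (↑u * ↑u⁻¹ : (Fin n → A) →L[ℂ] (Fin n → A)) b' = b' := by rw [u.mul_inv]; rfl
    exact this
  have hyx : y = ∑ i, b i * x i := by
    have h1 : y = ∑ j, b' j * s j := by rw [← hT, hb']
    have h2 : ∑ j, U b j * s j = ∑ i, b i * (s i - x i) := by
      simp_rw [hU, ← hc, Finset.mul_sum, Finset.sum_mul, mul_assoc]
      exact Finset.sum_comm
    rw [h1, ← hb]
    simp only [Pi.sub_apply, sub_mul, Finset.sum_sub_distrib, h2, mul_sub]
    abel
  rw [hyx]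
  exact I.sum_mem fun i _ => I.mul_mem_left _ (hxI i)

/-- A finitely generated left ideal with Noetherian quotient is closed. -/
theorem isClosed_of_fg_of_isNoetherian {I : Ideal A} (hI : I.FG) [IsNoetherian A (A ⧸ I)] :
    IsClosed (I : Set A) := by
  have hle : I ≤ I.closure := subset_closure
  have hfg : I.closure.FG := by
    refine Submodule.fg_of_fg_map_of_fg_inf_ker I.mkQ (IsNoetherian.noetherian _) ?_
    rwa [Submodule.ker_mkQ, inf_eq_right.mpr hle]
  rw [eq_of_le_closure hle subset_rfl isClosed_closure hfg]
  exact isClosed_closure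

end Closed

/-! ### The maps `x ↦ s x t` -/

section Sandwich
variable {A : Type*} [Ring A] [Algebra ℂ A]

/-- The operator `x ↦ s x t`. -/
noncomputable def sandwich (s t : A) : A →ₗ[ℂ] A :=
  LinearMap.mulRight ℂ t ∘ₗ LinearMap.mulLeft ℂ s

@[simp]
theorem sandwich_apply (s t x : A) : sandwich s t x = s * x * t := rfl

theorem finiteDimensional_range_sandwich_zero_left (t : A) :
    FiniteDimensional ℂ (LinearMap.range (sandwich 0 t)) := by
  have : sandwich 0 t = 0 := by ext; simp
  rw [this, LinearMap.range_zero]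
  infer_instance

theorem finiteDimensional_range_sandwich_zero_right (s : A) :
    FiniteDimensional ℂ (LinearMap.range (sandwich s 0)) := by
  have : sandwich s 0 = 0 := by ext; simp
  rw [this, LinearMap.range_zero]
  infer_instance

theorem finiteDimensional_range_sandwich_add_left {s s' t : A}
    (h : FiniteDimensional ℂ (LinearMap.range (sandwich s t)))
    (h' : FiniteDimensional ℂ (LinearMap.range (sandwich s' t))) :
    FiniteDimensional ℂ (LinearMap.range (sandwich (s + s') t)) := by
  have : sandwich (s + s') t = sandwich s t + sandwich s' t := by ext; simp [add_mul]
  rw [this]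
  exact Submodule.finiteDimensional_of_le (LinearMap.range_add_le _ _)

theorem finiteDimensional_range_sandwich_add_right {s t t' : A}
    (h : FiniteDimensional ℂ (LinearMap.range (sandwich s t)))
    (h' : FiniteDimensional ℂ (LinearMap.range (sandwich s t'))) :
    FiniteDimensional ℂ (LinearMap.range (sandwich s (t + t'))) := by
  have : sandwich s (t + t') = sandwich s t + sandwich s t' := by ext; simp [mul_add]
  rw [this]
  exact Submodule.finiteDimensional_of_le (LinearMap.range_add_le _ _)

end Sandwich

/-! ### Schur's lemma and finite rank over the socle -/

section GelfandMazur
variable {A : Type*} [NormedRing A] [NormedAlgebra ℂ A] [CompleteSpace A]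

/-- `f` is induced by a right multiplication, hence is continuous on the Banach space `A ⧸ M` and
has a spectral value `z`; `z - f` is not bijective, so it vanishes by simplicity. -/
theorem exists_eq_smul_of_isMaximal (M : Ideal A) [hM : M.IsMaximal] (f : Module.End A (A ⧸ M)) :
    ∃ z : ℂ, ∀ x, f x = z • x := by
  have : IsSimpleModule A (A ⧸ M) := isSimpleModule_iff_isCoatom.mpr hM.out
  have : Nontrivial (A ⧸ M) := IsSimpleModule.nontrivial A _
  have hcont : Continuous f := by
    have hq : Topology.IsQuotientMap (Submodule.Quotient.mk : A → A ⧸ M) := isQuotientMap_quot_mk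
    rw [hq.continuous_iff]
    obtain ⟨c, hc⟩ := Submodule.Quotient.mk_surjective M (f (Submodule.Quotient.mk 1))
    have : (f ∘ Submodule.Quotient.mk : A → A ⧸ M) =
        Submodule.Quotient.mk ∘ fun x => x * c := by
      ext x
      simp only [Function.comp_apply]
      rw [← smul_eq_mul, Submodule.Quotient.mk_smul, hc, ← map_smul, ← Submodule.Quotient.mk_smul,
        smul_eq_mul, mul_one]
    rw [this]
    exact hq.continuous.comp (continuous_mul_const c)
  let F : (A ⧸ M) →L[ℂ] (A ⧸ M) := ⟨f.restrictScalars ℂ, hcont⟩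
  obtain ⟨z, hz⟩ := spectrum.nonempty F
  refine ⟨z, ?_⟩
  let g : Module.End A (A ⧸ M) := z • LinearMap.id - f
  rcases LinearMap.bijective_or_eq_zero g with h | h
  · refine absurd ?_ hz
    rw [spectrum.mem_resolventSet_iff, ContinuousLinearMap.isUnit_iff_bijective]
    have : ⇑(algebraMap ℂ ((A ⧸ M) →L[ℂ] (A ⧸ M)) z - F) = g := by
      ext x
      rfl
    rwa [this]
  · intro x
    have := LinearMap.congr_fun h x
    exact (sub_eq_zero.mp this).symm

/-- Schur's lemma for simple left modules over a complex Banach algebra. -/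
theorem exists_eq_smul_of_isSimpleModule {N : Type*} [AddCommGroup N] [Module A N] [Module ℂ N]
    [IsScalarTower ℂ A N] [IsSimpleModule A N] (f : Module.End A N) :
    ∃ z : ℂ, ∀ x, f x = z • x := by
  obtain ⟨M, hM, ⟨e⟩⟩ := isSimpleModule_iff_quot_maximal.mp ‹IsSimpleModule A N›
  obtain ⟨z, hz⟩ := exists_eq_smul_of_isMaximal M (e.toLinearMap ∘ₗ f ∘ₗ e.symm.toLinearMap)
  refine ⟨z, fun x => e.injective ?_⟩
  have h1 := hz (e x)
  simp only [LinearMap.comp_apply, LinearEquiv.coe_coe, LinearEquiv.symm_apply_apply] at h1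
  rw [h1]
  exact ((e.toLinearMap.restrictScalars ℂ).map_smul z x).symm

/-- Right multiplications by `x * t` are module maps `m → m'`, so by Schur all are scalar multiples
of a single one. -/
theorem finiteDimensional_range_sandwich_of_isAtom {m m' : Ideal A} (hm : IsAtom m)
    (hm' : IsAtom m') {s t : A} (hs : s ∈ m) (ht : t ∈ m') :
    FiniteDimensional ℂ (LinearMap.range (sandwich s t)) := by
  have : IsSimpleModule A m := isSimpleModule_iff_isAtom.mpr hm
  have : IsSimpleModule A m' := isSimpleModule_iff_isAtom.mpr hm'
  let ρ : A → (m →ₗ[A] m') := fun x =>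
    ((LinearMap.toSpanSingleton A A (x * t)).comp m.subtype).codRestrict m' fun y =>
      m'.mul_mem_left _ (m'.mul_mem_left _ ht)
  have hρ : ∀ x (y : m), (ρ x y : A) = y * (x * t) := fun x y => rfl
  by_cases h0 : ∀ x, ρ x = 0
  · have : LinearMap.range (sandwich s t) = ⊥ := by
      rw [LinearMap.range_eq_bot]
      ext x
      have := congrArg Subtype.val (LinearMap.congr_fun (h0 x) ⟨s, hs⟩)
      rw [hρ] at this
      simpa [mul_assoc] using this
    rw [this]
    infer_instance
  push Not at h0
  obtain ⟨x₀, hx₀⟩ := h0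
  let e := LinearEquiv.ofBijective _ ((LinearMap.bijective_or_eq_zero (ρ x₀)).resolve_right hx₀)
  have hle : LinearMap.range (sandwich s t) ≤ ℂ ∙ (s * x₀ * t) := by
    rintro _ ⟨x, rfl⟩
    obtain ⟨z, hz⟩ := exists_eq_smul_of_isSimpleModule (e.symm.toLinearMap ∘ₗ ρ x)
    refine Submodule.mem_span_singleton.mpr ⟨z, ?_⟩
    have h1 := hz ⟨s, hs⟩
    have h2 : ρ x ⟨s, hs⟩ = ρ x₀ (z • ⟨s, hs⟩) := by
      rw [← h1]
      exact (e.apply_symm_apply _).symm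
    have h3 := congrArg Subtype.val h2
    rw [hρ, hρ] at h3
    rw [sandwich_apply, mul_assoc s x t]
    refine Eq.trans ?_ h3.symm
    simp [mul_assoc]
  exact Submodule.finiteDimensional_of_le hle

theorem finiteDimensional_range_sandwich {s t : A} (hs : s ∈ socle A) (ht : t ∈ socle A) :
    FiniteDimensional ℂ (LinearMap.range (sandwich s t)) := by
  rw [socle, sSup_eq_iSup'] at hs ht
  refine Submodule.iSup_induction _ (motive := fun s =>
    FiniteDimensional ℂ (LinearMap.range (sandwich s t))) hs (fun m s hs => ?_)
    (finiteDimensional_range_sandwich_zero_left t)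
    fun _ _ => finiteDimensional_range_sandwich_add_left
  refine Submodule.iSup_induction _ (motive := fun t =>
    FiniteDimensional ℂ (LinearMap.range (sandwich s t))) ht (fun m' t ht => ?_)
    (finiteDimensional_range_sandwich_zero_right s)
    fun _ _ => finiteDimensional_range_sandwich_add_right
  exact finiteDimensional_range_sandwich_of_isAtom m.2 m'.2 hs ht

end GelfandMazur
end CStarFredholm

namespace CStarFredholm

/-! ### Semisimplicity of the socle -/

section Algebraic
variable {A : Type*} [Ring A]

theorem isWeakPlusFredholm_iff {a : A} :
    IsWeakPlusFredholm a ↔ IsFiniteLength A (A ⧸ (Ideal.span {a} : Ideal A)) := by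
  rw [IsWeakPlusFredholm, xiLeft, lt_top_iff_ne_top, Module.length_ne_top_iff]

theorem isSemiPlusFredholm_iff {a : A} :
    IsSemiPlusFredholm a ↔ ∃ b : A, b * a - 1 ∈ socle A := by
  constructor
  · rintro ⟨b, hb⟩
    obtain ⟨b, rfl⟩ := Ideal.Quotient.mk_surjective b
    exact ⟨b, Ideal.Quotient.eq.mp (by simpa using hb)⟩
  · rintro ⟨b, hb⟩
    exact ⟨Ideal.Quotient.mk _ b, by simpa using Ideal.Quotient.eq.mpr hb⟩

instance isSemisimpleModule_socle : IsSemisimpleModule A (socle A) := by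
  rw [socle, sSup_eq_iSup]
  refine isSemisimpleModule_biSup_of_isSemisimpleModule_submodule fun m hm => ?_
  have : IsSimpleModule A m := isSimpleModule_iff_isAtom.mpr hm
  infer_instance

theorem le_socle_of_isSemisimpleModule (N : Ideal A) [IsSemisimpleModule A N] : N ≤ socle A := by
  have h : (⊤ : Submodule A N) ≤ Submodule.comap N.subtype (socle A) := by
    rw [← IsSemisimpleModule.sSup_simples_eq_top A N]
    refine sSup_le fun m hm => ?_
    rw [← Submodule.map_le_iff_le_comap]
    have : IsSimpleModule A m := hm
    exact le_sSup (isSimpleModule_iff_isAtom.mp (IsSimpleModule.congr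
      (Submodule.equivMapOfInjective N.subtype N.injective_subtype m).symm))
  exact fun x hx => h (Submodule.mem_top (x := ⟨x, hx⟩))

/-- Modulo `Aa`, each `x` equals `-x(ba - 1)`, so the socle surjects onto `A/Aa`; a finitely
generated semisimple module has finite length. -/
theorem IsSemiPlusFredholm.isWeakPlusFredholm {a : A} (ha : IsSemiPlusFredholm a) :
    IsWeakPlusFredholm a := by
  obtain ⟨b, hb⟩ := isSemiPlusFredholm_iff.mp ha
  rw [isWeakPlusFredholm_iff]
  have hsurj : Function.Surjective
      ((Ideal.span {a} : Ideal A).mkQ ∘ₗ (socle A).subtype) := by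
    intro y
    obtain ⟨x, rfl⟩ := Submodule.mkQ_surjective _ y
    refine ⟨⟨-(x * (b * a - 1)), neg_mem (Ideal.mul_mem_left _ x hb)⟩, ?_⟩
    refine (Submodule.Quotient.eq _).mpr (Ideal.mem_span_singleton'.mpr ⟨-(x * b), ?_⟩)
    simp only [Submodule.subtype_apply]
    noncomm_ring
  have := IsSemisimpleModule.of_surjective _ hsurj
  have := (IsSemisimpleModule.finite_tfae (R := A)
    (M := A ⧸ (Ideal.span {a} : Ideal A))).out 0 3
  exact this.mp inferInstance

end Algebraic

/-! ### The equivalences in a C*-algebra -/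

section CStar
variable {A : Type*} [CStarAlgebra A]

/-- For `h = x*x` in the radical and real `t ≠ 0`, `1 - t⁻¹h` is left invertible and self-adjoint,
hence invertible. So `h` has no nonzero spectrum and vanishes. -/
theorem jacobson_eq_bot : Ring.jacobson A = ⊥ := by
  refine (Submodule.eq_bot_iff _).mpr fun x hx => ?_
  set h := star x * x with hh
  have hsa : IsSelfAdjoint h := IsSelfAdjoint.star_mul_self x
  have hmem : h ∈ (⊥ : Ideal A).jacobson := by
    rw [Ideal.jacobson_bot]
    exact Ideal.mul_mem_left _ _ hx
  have hspec : ∀ t ∈ spectrum ℝ h, t = 0 := by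
    intro t ht
    by_contra h0
    refine ht ?_
    obtain ⟨z, hz⟩ := Ideal.mem_jacobson_iff.mp hmem (algebraMap ℝ A (-t⁻¹))
    rw [Submodule.mem_bot] at hz
    set u := 1 + algebraMap ℝ A (-t⁻¹) * h with hu
    have hzu : z * u = 1 := by
      rw [← sub_eq_zero, ← hz, hu]; noncomm_ring
    have husa : star u = u := by
      rw [hu, star_add, star_mul, hsa.star_eq, star_one, ← algebraMap_star_comm,
        Algebra.commutes, star_trivial]
    have huz : u * star z = 1 := by
      rw [← husa, ← star_mul, hzu, star_one]
    have hunit : IsUnit u := ⟨⟨u, star z, huz, left_inv_eq_right_inv hzu huz ▸ hzu⟩, rfl⟩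
    have : algebraMap ℝ A t - h = algebraMap ℝ A t * u := by
      rw [hu, mul_add, mul_one, ← mul_assoc, ← map_mul, mul_neg, mul_inv_cancel₀ h0]
      simp [sub_eq_add_neg]
    rw [spectrum.mem_resolventSet_iff, this]
    exact ((IsUnit.mk0 t h0).map _).mul hunit
  have h0 : h = 0 := by
    rw [← cfc_id' ℝ h, cfc_congr (g := fun _ => 0) fun t ht => hspec t ht, cfc_const_zero]
  exact CStarRing.star_mul_self_eq_zero_iff _ |>.mp h0

theorem le_socle_of_isArtinian (N : Ideal A) [IsArtinian A N] : N ≤ socle A := by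
  have : IsSemisimpleModule A N := IsArtinian.isSemisimpleModule_iff_jacobson A N |>.mpr
    (Module.jacobson_eq_bot_of_injective N.subtype N.injective_subtype jacobson_eq_bot)
  exact le_socle_of_isSemisimpleModule N

/-- The complementary projection of a closed principal left ideal. -/
theorem exists_compl_projection {a : A} (ha : IsClosed ((Ideal.span {a} : Ideal A) : Set A)) :
    ∃ q b : A, IsStarProjection q ∧ b * a = 1 - q ∧ a * q = 0 := by
  obtain ⟨b, hb, hab⟩ := exists_projection_of_isClosed a ha
  exact ⟨1 - b * a, b, hb.one_sub, by simp, by rw [mul_sub, mul_one, hab, sub_self]⟩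

theorem IsWeakPlusFredholm.isClosed {a : A} (ha : IsWeakPlusFredholm a) :
    IsClosed ((Ideal.span {a} : Ideal A) : Set A) := by
  have := (isFiniteLength_iff_isNoetherian_isArtinian.mp (isWeakPlusFredholm_iff.mp ha)).1
  exact isClosed_of_fg_of_isNoetherian (Submodule.fg_span (Set.finite_singleton a))

/-- Right multiplication by `q` kills `Aa`, so its image `Aq` is Artinian. -/
theorem IsWeakPlusFredholm.mem_socle {a q : A} (ha : IsWeakPlusFredholm a) (haq : a * q = 0) :
    q ∈ socle A := by
  have := (isFiniteLength_iff_isNoetherian_isArtinian.mp (isWeakPlusFredholm_iff.mp ha)).2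
  let f : (A ⧸ (Ideal.span {a} : Ideal A)) →ₗ[A] A :=
    (Ideal.span {a} : Ideal A).liftQ (LinearMap.toSpanSingleton A A q) <| by
      rw [Ideal.span, Submodule.span_singleton_le_iff_mem]
      exact haq
  exact le_socle_of_isArtinian (LinearMap.range f) ⟨Submodule.Quotient.mk 1, one_mul q⟩

theorem IsWeakPlusFredholm.isSemiPlusFredholm {a : A} (ha : IsWeakPlusFredholm a) :
    IsSemiPlusFredholm a := by
  obtain ⟨q, b, -, hb, haq⟩ := exists_compl_projection ha.isClosed
  exact isSemiPlusFredholm_iff.mpr ⟨b, by simpa [hb] using ha.mem_socle haq⟩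

theorem delta_lt_top_iff {L : Ideal A} : delta L < ⊤ ↔ FiniteDimensional ℂ (A ⧸ addStar L) := by
  rw [delta, Cardinal.toENat_lt_top, Module.rank_lt_aleph0_iff]

theorem mem_addStar_of_mem {L : Ideal A} {x : A} (hx : x ∈ L) : x ∈ addStar L :=
  Submodule.mem_sup_left hx

theorem star_mem_addStar_of_mem {L : Ideal A} {x : A} (hx : x ∈ L) : star x ∈ addStar L :=
  Submodule.mem_sup_right ⟨x, hx, rfl⟩

/-- The map `x ↦ qxq` kills `Aa + (Aa)*`, while `x = x(1 - q) + (1 - q)xq + qxq` has its first two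
terms in that space. -/
theorem delta_lt_top_iff_sandwich {a b q : A} (hq : IsStarProjection q) (hb : b * a = 1 - q)
    (haq : a * q = 0) : delta (Ideal.span {a} : Ideal A) < ⊤ ↔
      FiniteDimensional ℂ (LinearMap.range (sandwich q q)) := by
  rw [delta_lt_top_iff]
  have hmem : 1 - q ∈ (Ideal.span {a} : Ideal A) := Ideal.mem_span_singleton'.mpr ⟨b, hb⟩
  have hqs : star q = q := hq.isSelfAdjoint.star_eq
  constructor
  · intro _
    have hle : addStar (Ideal.span {a} : Ideal A) ≤ LinearMap.ker (sandwich q q) := by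
      refine sup_le (fun x hx => ?_) ?_
      · obtain ⟨c, rfl⟩ := Ideal.mem_span_singleton'.mp hx
        simp [mul_assoc, haq]
      · rintro _ ⟨x, hx, rfl⟩
        obtain ⟨c, rfl⟩ := Ideal.mem_span_singleton'.mp hx
        have : q * star a = 0 := by rw [← hqs, ← star_mul, haq, star_zero]
        simp [← mul_assoc, this]
    rw [← Submodule.range_liftQ _ (sandwich q q) hle]
    infer_instance
  · intro _
    refine Module.Finite.of_surjective
      ((addStar (Ideal.span {a} : Ideal A)).mkQ ∘ₗ (LinearMap.range (sandwich q q)).subtype) ?_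
    intro y
    obtain ⟨x, rfl⟩ := Submodule.mkQ_surjective _ y
    refine ⟨⟨_, x, rfl⟩, ?_⟩
    refine Eq.symm ((Submodule.Quotient.eq _).mpr ?_)
    have h1 : x * (1 - q) ∈ addStar (Ideal.span {a} : Ideal A) :=
      mem_addStar_of_mem (Ideal.mul_mem_left _ _ hmem)
    have h2 : (1 - q) * (x * q) ∈ addStar (Ideal.span {a} : Ideal A) := by
      have := star_mem_addStar_of_mem (Ideal.mul_mem_left _ (star (x * q)) hmem)
      rwa [star_mul, star_star, star_sub, star_one, hqs] at this
    convert add_mem h1 h2 using 1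
    simp only [Submodule.subtype_apply, sandwich_apply]
    noncomm_ring

theorem IsWeakPlusFredholm.delta_lt_top {a : A} (ha : IsWeakPlusFredholm a) :
    delta (Ideal.span {a} : Ideal A) < ⊤ := by
  obtain ⟨q, b, hq, hb, haq⟩ := exists_compl_projection ha.isClosed
  have hs := ha.mem_socle haq
  exact (delta_lt_top_iff_sandwich hq hb haq).mpr (finiteDimensional_range_sandwich hs hs)

open Polynomial in
/-- An element whose positive powers span a finite-dimensional space has finite spectrum. -/
theorem finite_spectrum_of_pow_mem {h : A} (W : Submodule ℂ A) [FiniteDimensional ℂ W]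
    (hW : ∀ n : ℕ, h ^ (n + 1) ∈ W) : (spectrum ℝ h).Finite := by
  have hmem : ∀ P : ℂ[X], aeval h (P * X) ∈ W := by
    intro P
    rw [map_mul, aeval_X, aeval_eq_sum_range, Finset.sum_mul]
    refine W.sum_mem fun n _ => ?_
    rw [smul_mul_assoc, ← pow_succ]
    exact W.smul_mem _ (hW n)
  -- The factor `X` keeps only positive powers of `h`, as `1` need not lie in `W`.
  let f : ℂ[X] →ₗ[ℂ] W :=
    ((aeval h).toLinearMap ∘ₗ LinearMap.mulRight ℂ X).codRestrict W hmem
  have hf : ¬ Function.Injective f := fun hinj =>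
    Polynomial.not_finite (R := ℂ) (Module.Finite.of_injective f hinj)
  rw [← LinearMap.ker_eq_bot, Submodule.eq_bot_iff] at hf
  push Not at hf
  obtain ⟨P, hP, hP0⟩ := hf
  have hPX : aeval h (P * X) = 0 := congrArg Subtype.val hP
  have hC : (spectrum ℂ h).Finite := by
    rcases subsingleton_or_nontrivial A with hA | hA
    · rw [spectrum.of_subsingleton]
      exact Set.finite_empty
    refine (rootSet_finite (P * X) ℂ).subset fun z hz => ?_
    have := spectrum.subset_polynomial_aeval h (P * X) ⟨z, hz, rfl⟩
    rw [hPX, spectrum.zero_eq, Set.mem_singleton_iff] at this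
    exact mem_rootSet.mpr ⟨mul_ne_zero hP0 X_ne_zero, by simpa using this⟩
  rw [← spectrum.preimage_algebraMap ℂ]
  exact hC.preimage (FaithfulSMul.algebraMap_injective ℝ ℂ).injOn

/-- For `y = xq` with `x ∈ J`, `y*y` lies in `qJq ⊆ qIq ⊆ I`. Its positive powers stay in `qAq`, so
its spectrum is finite and the support projection gives `y ∈ A(y*y) ⊆ I`. -/
theorem le_of_map_sandwich_le {q : A} (hq : IsStarProjection q)
    [FiniteDimensional ℂ (LinearMap.range (sandwich q q))] {I J : Ideal A} (hI : 1 - q ∈ I)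
    (hJ : 1 - q ∈ J)
    (hIJ : (J.restrictScalars ℂ).map (sandwich q q) ≤ (I.restrictScalars ℂ).map (sandwich q q)) :
    J ≤ I := by
  intro x hx
  have hqs : star q = q := hq.isSelfAdjoint.star_eq
  have hqq : q * q = q := hq.isIdempotentElem
  have hJq : ∀ K : Ideal A, 1 - q ∈ K → ∀ x ∈ K, x * q ∈ K := fun K hK x hx => by
    have : x * q = x - x * (1 - q) := by noncomm_ring
    rw [this]
    exact K.sub_mem hx (K.mul_mem_left _ hK)
  set y := x * q with hy
  have hyJ : y ∈ J := hJq J hJ x hx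
  have hyq : y * q = y := by rw [hy, mul_assoc, hqq]
  set h := star y * y with hh
  have hqh : q * h = h := by
    rw [hh, ← mul_assoc]
    nth_rewrite 1 [← hqs]
    rw [← star_mul, hyq]
  have hhq : h * q = h := by rw [hh, mul_assoc, hyq]
  have hhI : h ∈ I := by
    have : h ∈ (J.restrictScalars ℂ).map (sandwich q q) :=
      ⟨h, J.mul_mem_left _ hyJ, by rw [sandwich_apply, hqh, hhq]⟩
    obtain ⟨z, hz, hzh⟩ := hIJ this
    rw [← hzh, sandwich_apply, mul_assoc]
    exact I.mul_mem_left _ (hJq I hI z hz)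
  have hfin : (spectrum ℝ h).Finite := by
    refine finite_spectrum_of_pow_mem (LinearMap.range (sandwich q q)) fun n => ⟨h ^ (n + 1), ?_⟩
    rw [sandwich_apply, pow_succ', ← mul_assoc, hqh, ← pow_succ', pow_succ, mul_assoc, hhq]
  obtain ⟨c, -, hyc⟩ := exists_support_projection y (hfin.continuousOn _)
  have hyI : y ∈ I := by
    rw [← hyc, ← mul_assoc]
    exact I.mul_mem_left _ hhI
  have : x = y + x * (1 - q) := by rw [hy]; noncomm_ring
  rw [this]
  exact I.add_mem hyI (I.mul_mem_left _ hI)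

/-- Taking corners embeds the submodule lattice, strictly monotonically, into the subspaces of
`qAq`, giving both chain conditions. -/
theorem isFiniteLength_of_finiteDimensional_sandwich {q : A} (hq : IsStarProjection q)
    [FiniteDimensional ℂ (LinearMap.range (sandwich q q))] {K : Ideal A} (hK : 1 - q ∈ K) :
    IsFiniteLength A (A ⧸ K) := by
  let φ : Submodule A (A ⧸ K) → Submodule ℂ (LinearMap.range (sandwich q q)) := fun N =>
    ((N.comap K.mkQ).restrictScalars ℂ).map (sandwich q q).rangeRestrict
  have hmono : Monotone φ := fun N N' h => Submodule.map_mono (Submodule.comap_mono h)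
  have hmap : ∀ N, (φ N).map (LinearMap.range (sandwich q q)).subtype =
      ((N.comap K.mkQ).restrictScalars ℂ).map (sandwich q q) := fun N => by
    rw [← Submodule.map_comp]
    rfl
  have hmem : ∀ N : Submodule A (A ⧸ K), 1 - q ∈ N.comap K.mkQ := fun N => by
    rw [Submodule.mem_comap, Submodule.mkQ_apply, (Submodule.Quotient.mk_eq_zero K).mpr hK]
    exact N.zero_mem
  have hφ : StrictMono φ := hmono.strictMono_of_injective fun N N' h => by
    have h' := congrArg (Submodule.map (LinearMap.range (sandwich q q)).subtype) h
    rw [hmap, hmap] at h'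
    exact Submodule.comap_injective_of_surjective K.mkQ_surjective (le_antisymm
      (le_of_map_sandwich_le hq (hmem _) (hmem _) h'.le)
      (le_of_map_sandwich_le hq (hmem _) (hmem _) h'.ge))
  exact isFiniteLength_iff_isNoetherian_isArtinian.mpr
    ⟨isNoetherian_iff'.mpr hφ.wellFoundedGT, hφ.wellFoundedLT⟩

theorem isWeakPlusFredholm_of_delta_lt_top {a : A}
    (hδ : delta (Ideal.span {a} : Ideal A) < ⊤)
    (ha : IsClosed ((Ideal.span {a} : Ideal A) : Set A)) : IsWeakPlusFredholm a := by
  obtain ⟨q, b, hq, hb, haq⟩ := exists_compl_projection ha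
  have := (delta_lt_top_iff_sandwich hq hb haq).mp hδ
  exact isWeakPlusFredholm_iff.mpr (isFiniteLength_of_finiteDimensional_sandwich hq
    (Ideal.mem_span_singleton'.mpr ⟨b, hb⟩))

end CStar
end CStarFredholm

theorem mainTheorem2 {A : Type*} [CStarAlgebra A] (a : A) :
    List.TFAE [
      CStarFredholm.IsWeakPlusFredholm a,
      CStarFredholm.IsSemiPlusFredholm a,
      CStarFredholm.delta (Ideal.span {a} : Ideal A) < ⊤ ∧
        IsClosed ((Ideal.span {a} : Ideal A) : Set A)] := by
  tfae_have 1 → 2 := CStarFredholm.IsWeakPlusFredholm.isSemiPlusFredholm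
  tfae_have 2 → 1 := CStarFredholm.IsSemiPlusFredholm.isWeakPlusFredholm
  tfae_have 1 → 3 := fun h => ⟨h.delta_lt_top, h.isClosed⟩
  tfae_have 3 → 1 := fun h => CStarFredholm.isWeakPlusFredholm_of_delta_lt_top h.1 h.2
  tfae_finish
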